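/- Let $\sigma_1,\sigma_2$ be the substitutions on the alphabet $\{1,2\}$ given by $\sigma_1: 1\mapsto 1,\ 2\mapsto 12$ and $\sigma_2: 1\mapsto 21,\ 2\mapsto 2$, extended to finite words as morphisms for concatenation. A sequence of finite words $(u_n)_n$ converges to an infinite word $w$ if every prefix of $w$ is a prefix of $u_n$ for all sufficiently large $n$. An infinite word $w$ is Sturmian if for every $n\in\mathbb{N}$ it has exactly $n+1$ distinct factors (blocks of consecutive letters) of length $n$. The frequency of the letter $a$ in $w$ is $\lim_{n\to\infty}\frac1n|\mathrm{pref}_n(w)|_a$, if this limit exists, where $|\mathrm{pref}_n(w)|_a$ is the number of occurrences of $a$ among the first $n$ letters of $w$. Theorem. Let $(s_n)_{n\ge 1}\in\{\sigma_1,\sigma_2\}^{\mathbb{N}_{\ge 1}}$ be a sequence in which both $\sigma_1$ and $\sigma_2$ occur infinitely often. Then: (i) the two sequences of finite words $(s_1\circ s_2\circ\cdots\circ s_n(1))_n$ and $(s_1\circ s_2\circ\cdots\circ s_n(2))_n$ converge, as $n\to\infty$, to the same infinite word $w_0$, and $w_0$ is Sturmian; (ii) the letters $1$ and $2$ have frequencies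 $f_1$ and $f_2$ in $w_0$, with $f_2\neq 0$, and if $(b_k)_{k\ge 0}$ is the run-length sequence of $(s_n)_n$ (that is, $b_0\ge 0$ is the number of times $\sigma_1$ is repeated before the first occurrence of $\sigma_2$, $b_1\geq 1$ is the number of times $\sigma_2$ is then repeated before the next occurrence of $\sigma_1$, and so on, so that $s_1s_2s_3\cdots=\sigma_1^{b_0}\sigma_2^{b_1}\sigma_1^{b_2}\sigma_2^{b_3}\cdots$), then $[b_0;b_1,b_2,b_3,\ldots]$ is the continued fraction expansion of $f_1/f_2$. -/

import Mathlib

open Filter Topology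

namespace SturmianWords

/-- The binary alphabet `{1, 2}`. -/
inductive Letter where
  | one
  | two
  deriving DecidableEq

section Words

variable {α : Type*}

/-- The block of `n` consecutive letters of the infinite word `w` starting at position `i`. -/
def block (w : ℕ → α) (i n : ℕ) : List α :=
  (List.range n).map fun k => w (i + k)

/-- The prefix of length `n` of the infinite word `w`. -/
def pref (w : ℕ → α) (n : ℕ) : List α :=
  block w 0 n

/-- The set `ℒₙ(w)` of factors of length `n` of the infinite word `w`. -/
def factors (w : ℕ → α) (n : ℕ) : Set (List α) :=
  {u | ∃ i, u = block w i n}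

/-- The complexity function of an infinite word: the number of its factors of length `n`. -/
noncomputable def complexity (w : ℕ → α) (n : ℕ) : ℕ :=
  (factors w n).ncard

/-- Sturmian words: infinite words of complexity `n ↦ n + 1`. -/
def IsSturmian (w : ℕ → α) : Prop :=
  ∀ n, complexity w n = n + 1

/-- The finite words `u n` converge to the infinite word `w`: they share larger and larger
prefixes with `w`, i.e. each prefix of `w` is a prefix of `u n` for all large `n`. -/
def ConvergesTo (u : ℕ → List α) (w : ℕ → α) : Prop :=
  ∀ N, ∀ᶠ n in atTop, pref w N <+: u n

/-- The letter `a` has frequency `f` in the infinite word `w`. -/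
def HasFrequency [DecidableEq α] (w : ℕ → α) (a : α) (f : ℝ) : Prop :=
  Tendsto (fun n : ℕ => ((pref w n).count a : ℝ) / n) atTop (𝓝 f)

end Words

/-- A substitution: a map from the alphabet to the finite words. -/
abbrev Substitution := Letter → List Letter

/-- The image of a finite word by a substitution, extended as a morphism for concatenation. -/
def Substitution.apply (s : Substitution) (u : List Letter) : List Letter :=
  u.flatMap s

/-- `σ₁ : 1 ↦ 1, 2 ↦ 12`. -/
def sigma1 : Substitution
  | .one => [.one]
  | .two => [.one, .two]

/-- `σ₂ : 1 ↦ 21, 2 ↦ 2`. -/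
def sigma2 : Substitution
  | .one => [.two, .one]
  | .two => [.two]

/-- The image of the finite word `u` by the composition of the first `n` substitutions of the
sequence, the first one being applied last: `(s 0 ∘ s 1 ∘ ⋯ ∘ s (n - 1)) u`. -/
def compose (s : ℕ → Substitution) : ℕ → List Letter → List Letter
  | 0, u => u
  | n + 1, u => compose s n (Substitution.apply (s n) u)

/-- The substitution repeated in the `k`-th run: `σ₁` for even `k`, `σ₂` for odd `k`. -/
def runValue (k : ℕ) : Substitution :=
  if Even k then sigma1 else sigma2

/-- The position at which the `k`-th run starts (runs are numbered from `0`, and the `0`-th run,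
consisting of `σ₁`'s, may be empty): the run `k + 1` starts at the first position, from the start
of the run `k` on, that does not carry the substitution of the run `k`. -/
noncomputable def runStart (s : ℕ → Substitution) : ℕ → ℕ
  | 0 => 0
  | k + 1 => sInf {n | runStart s k ≤ n ∧ s n ≠ runValue k}

/-- The run-length sequence: the number of times `σ₁` is repeated before the first `σ₂`, then the
number of times `σ₂` is repeated before the next `σ₁`, and so on. -/
noncomputable def runLength (s : ℕ → Substitution) (k : ℕ) : ℕ :=
  runStart s (k + 1) - runStart s k

/-- `[b 0; b 1, b 2, …]` is the (infinite) continued fraction expansion of the real number `x`,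
as computed by the algorithm of successive integer and fractional parts. -/
def IsContFractExpansion (b : ℕ → ℕ) (x : ℝ) : Prop :=
  (GenContFract.of x).h = b 0 ∧
    ∀ n, (GenContFract.of x).s.get? n = some ⟨1, (b (n + 1) : ℝ)⟩

end SturmianWords

open SturmianWords

/-!
Write `s n = σ_a` with `a = d n`, where `σ_a` fixes `a` and puts `a` in front of every other letter.

*Complexity.* Removing `σ_a` from a word shortens its factors and preserves the shape of the sets of
two-sided extensions, so in the images of the letters every extension graph is a star: a factor
`b x b` forces every factor `c x a` to have `c = b` or `a = b`. Every letter precedes every prefix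
of the limit word `w`. If `u` were left special without being a prefix, let `x` be the longest
common prefix of `u` and `w`, followed by `b` in `w`: then `b x b` is a factor, while `u` starts
with `x a` for some `a ≠ b`, so `b` is the only left extension of `u`. Hence the prefixes are
the only left special factors, and the complexity grows by one at each length.

*Frequencies.* Counting letters, the removal of `σ_a` from the words sends the ratio `f : g` of `a`
to the other letter `b` to `(f - g) : g`, which is a subtractive Euclidean step. Along these steps
`g |u|_a - f |u|_b` varies by at most `f + g` over the prefixes `u`, whence the frequencies. A run
of length `k` subtracts `k` times and leaves `0 < f - k g < g`, since both letters occur again: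
the run length is the integer part of `f / g`, and the next run starts with the ratio `g : f - k g`.
-/

namespace SturmianWords

section Directed

variable {α : Type*} [DecidableEq α]

/-- The substitution `σ_a` that fixes the letter `a` and puts `a` in front of every other letter;
`σ₁` and `σ₂` are its instances on the binary alphabet. -/
def sigma (a b : α) : List α :=
  if b = a then [a] else [a, b]

@[simp] theorem sigma_self (a : α) : sigma a a = [a] := by simp [sigma]

@[simp] theorem sigma_of_ne {a b : α} (h : b ≠ a) : sigma a b = [a, b] := by simp [sigma, h]

theorem count_flatMap_sigma_self (a : α) (u : List α) :
    (u.flatMap (sigma a)).count a = u.length := by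
  induction u with
  | nil => rfl
  | cons c u ih => by_cases hc : c = a <;> simp [hc, ih]

theorem count_flatMap_sigma_of_ne {a b : α} (hb : b ≠ a) (u : List α) :
    (u.flatMap (sigma a)).count b = u.count b := by
  induction u with
  | nil => rfl
  | cons c u ih => by_cases hc : c = a <;> simp [hc, ih, List.count_cons, hb.symm]

/-- The image of the letter `a` by `σ_{d 0} ∘ ⋯ ∘ σ_{d (n - 1)}`. -/
def directedWord (d : ℕ → α) : ℕ → α → List α
  | 0, a => [a]
  | n + 1, a => (sigma (d n) a).flatMap (directedWord d n)

variable {d : ℕ → α}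

theorem directedWord_succ_self (n : ℕ) :
    directedWord d (n + 1) (d n) = directedWord d n (d n) := by
  simp [directedWord]

theorem directedWord_succ_of_ne {n : ℕ} {a : α} (h : a ≠ d n) :
    directedWord d (n + 1) a = directedWord d n (d n) ++ directedWord d n a := by
  simp [directedWord, h]

theorem directedWord_succ_eq_flatMap_sigma (n : ℕ) (a : α) :
    directedWord d (n + 1) a =
      (directedWord (fun k => d (k + 1)) n a).flatMap (sigma (d 0)) := by
  induction n generalizing a with
  | zero => simp [directedWord, List.flatMap_singleton']
  | succ n ih => rw [directedWord, funext ih, ← List.flatMap_assoc]; rfl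

theorem directedWord_prefix_directedWord {n m : ℕ} (h : n < m) (a : α) :
    directedWord d n (d n) <+: directedWord d m a := by
  induction m, h using Nat.le_induction generalizing a with
  | base =>
    by_cases ha : a = d n
    · rw [ha, directedWord_succ_self]
    · rw [directedWord_succ_of_ne ha]; exact List.prefix_append _ _
  | succ m _ ih =>
    by_cases ha : a = d m
    · rw [ha, directedWord_succ_self]; exact ih _
    · rw [directedWord_succ_of_ne ha]; exact (ih _).trans (List.prefix_append _ _)

theorem directedWord_suffix_directedWord {n m : ℕ} (h : n ≤ m) (a : α) :
    directedWord d n a <:+ directedWord d m a := by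
  induction m, h using Nat.le_induction with
  | base => exact List.suffix_rfl
  | succ m _ ih =>
    by_cases ha : a = d m
    · rwa [ha, directedWord_succ_self, ← ha]
    · rw [directedWord_succ_of_ne ha]; exact ih.trans (List.suffix_append _ _)

theorem singleton_suffix_directedWord (n : ℕ) (a : α) : [a] <:+ directedWord d n a :=
  directedWord_suffix_directedWord n.zero_le a

theorem exists_le_length_directedWord (hd : ∀ a, ∃ᶠ n in atTop, d n ≠ a) (N : ℕ) :
    ∃ n, N ≤ (directedWord d n (d n)).length := by
  induction N with
  | zero => exact ⟨0, Nat.zero_le _⟩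
  | succ N ih =>
    obtain ⟨n, hn⟩ := ih
    obtain ⟨m, hnm, hm⟩ := frequently_atTop.1 (hd (d n)) (n + 1)
    have hlen := (directedWord_suffix_directedWord (d := d) hnm (d m)).length_le
    have hpos : 1 ≤ (directedWord d n (d m)).length :=
      (singleton_suffix_directedWord n (d m)).length_le
    rw [directedWord_succ_of_ne hm, List.length_append] at hlen
    exact ⟨m, by omega⟩

end Directed

section Factors

variable {α : Type*} {w : ℕ → α}

@[simp] theorem length_block (w : ℕ → α) (i n : ℕ) : (block w i n).length = n := by
  simp [block]

@[simp] theorem length_pref (w : ℕ → α) (n : ℕ) : (pref w n).length = n :=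
  length_block w 0 n

theorem block_add (w : ℕ → α) (i m n : ℕ) :
    block w i (m + n) = block w i m ++ block w (i + m) n := by
  simp [block, List.range_add, Function.comp_def, Nat.add_assoc]

theorem block_succ (w : ℕ → α) (i n : ℕ) : block w i (n + 1) = w i :: block w (i + 1) n := by
  rw [Nat.add_comm n, block_add]; simp [block]

theorem pref_prefix_pref (w : ℕ → α) {m n : ℕ} (h : m ≤ n) : pref w m <+: pref w n := by
  obtain ⟨k, rfl⟩ := Nat.exists_eq_add_of_le h
  rw [pref, pref, block_add]
  exact List.prefix_append _ _

theorem block_infix_pref (w : ℕ → α) (i n : ℕ) : block w i n <:+: pref w (i + n) := by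
  rw [pref, block_add, Nat.zero_add]
  exact (List.suffix_append _ _).isInfix

theorem mem_factors_of_infix_pref {u : List α} {N : ℕ} (h : u <:+: pref w N) :
    u ∈ factors w u.length := by
  obtain ⟨p, q, h⟩ := h
  have hN : N = p.length + u.length + q.length := by
    simpa [Nat.add_assoc] using (congrArg List.length h).symm
  rw [hN, pref, block_add, block_add, Nat.zero_add] at h
  exact ⟨p.length, (List.append_inj (List.append_inj h (by simp)).1 (by simp)).2⟩

theorem finite_factors [Finite α] (w : ℕ → α) (n : ℕ) : (factors w n).Finite :=
  (List.finite_length_eq α n).subset fun u ⟨i, hi⟩ => by simp [hi]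

theorem factors_zero (w : ℕ → α) : factors w 0 = {[]} := by
  ext u; simp [factors, block]

end Factors

section Convergence

variable {α : Type*} {u v : ℕ → List α} {w : ℕ → α}

theorem exists_convergesTo_of_prefix_chain (hu : ∀ ⦃n m⦄, n < m → u n <+: u m)
    (hlen : ∀ N, ∃ n, N ≤ (u n).length) : ∃ w : ℕ → α, ConvergesTo u w := by
  choose k hk using fun i => hlen (i + 1)
  let w : ℕ → α := fun i => (u (k i))[i]'(hk i)
  have hw : ∀ n, u n = pref w (u n).length := fun n => by
    refine List.ext_getElem (by simp) fun i hi _ => ?_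
    simp only [pref, block, List.getElem_map, List.getElem_range, Nat.zero_add, w]
    rcases lt_trichotomy n (k i) with h | rfl | h
    · exact (hu h).getElem hi
    · rfl
    · exact ((hu h).getElem (hk i)).symm
  refine ⟨w, fun N => ?_⟩
  obtain ⟨n, hn⟩ := hlen N
  filter_upwards [eventually_gt_atTop n] with m hm
  exact ((pref_prefix_pref w hn).trans (hw n ▸ List.prefix_rfl)).trans (hu hm)

theorem ConvergesTo.of_eventually_prefix (hu : ConvergesTo u w)
    (h : ∀ n, ∀ᶠ m in atTop, u n <+: v m) : ConvergesTo v w := fun N => by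
  obtain ⟨n, hn⟩ := (hu N).exists
  exact (h n).mono fun m hm => hn.trans hm

theorem ConvergesTo.eq_pref (hu : ConvergesTo u w) {p : List α}
    (hp : ∀ᶠ n in atTop, p <+: u n) : p = pref w p.length := by
  obtain ⟨n, hpn, hwn⟩ := (hp.and (hu p.length)).exists
  exact (List.prefix_of_prefix_length_le hpn hwn (by simp)).eq_of_length (by simp)

theorem exists_convergesTo_directedWord [DecidableEq α] {d : ℕ → α}
    (hd : ∀ a, ∃ᶠ n in atTop, d n ≠ a) :
    ∃ w, ∀ a, ConvergesTo (fun n => directedWord d n a) w := by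
  obtain ⟨w, hw⟩ := exists_convergesTo_of_prefix_chain
    (fun n m h => directedWord_prefix_directedWord h (d m)) (exists_le_length_directedWord hd)
  exact ⟨w, fun a => hw.of_eventually_prefix fun n =>
    (eventually_gt_atTop n).mono fun m hm => directedWord_prefix_directedWord hm a⟩

theorem ConvergesTo.directedWord_eq_pref [DecidableEq α] {d : ℕ → α} {a : α}
    (hw : ConvergesTo (fun n => directedWord d n a) w) (n : ℕ) :
    directedWord d n (d n) = pref w (directedWord d n (d n)).length :=
  hw.eq_pref <| (eventually_gt_atTop n).mono fun _ hm => directedWord_prefix_directedWord hm a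

end Convergence

section Desubstitution

variable {α : Type*} [DecidableEq α] {a b c e : α} {x u V W Q : List α}

theorem eq_of_cons_prefix_flatMap_sigma (h : c :: Q <+: W.flatMap (sigma e)) : c = e := by
  rcases W with _ | ⟨s, W⟩
  · simp at h
  · by_cases hs : s = e <;> simp only [List.flatMap_cons, hs, sigma_self, sigma_of_ne,
      List.cons_append, List.cons_prefix_cons, not_false_eq_true, ne_eq] at h <;> exact h.1

theorem exists_prefix_of_prefix_flatMap_sigma (h : u <+: V.flatMap (sigma e)) :
    ∃ U, U <+: V ∧ (u = U.flatMap (sigma e) ∨ u = U.flatMap (sigma e) ++ [e]) := by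
  induction V using List.reverseRecOn with
  | nil => exact ⟨[], List.prefix_rfl, .inl (by simpa using h)⟩
  | append_singleton V s ih =>
    have ih' (h : u <+: V.flatMap (sigma e)) := (ih h).imp fun U hU =>
      And.imp_left (·.trans (List.prefix_append V [s])) hU
    by_cases hs : s = e
    · rw [hs, List.flatMap_append, List.flatMap_singleton, sigma_self, List.prefix_concat_iff] at h
      rcases h with rfl | h
      · exact ⟨V, List.prefix_append _ _, .inr rfl⟩
      · exact ih' h
    · rw [List.flatMap_append, List.flatMap_singleton, sigma_of_ne hs, List.append_cons,
        List.prefix_concat_iff, List.prefix_concat_iff] at h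
      rcases h with rfl | rfl | h
      · exact ⟨V ++ [s], List.prefix_rfl, .inl (by simp [hs])⟩
      · exact ⟨V, List.prefix_append _ _, .inr rfl⟩
      · exact ih' h

theorem exists_eq_flatMap_sigma_append (ha : a ≠ e) (h : x ++ [a] <+: W.flatMap (sigma e)) :
    ∃ y : List α, x = y.flatMap (sigma e) ++ [e] := by
  obtain ⟨V, -, hV | hV⟩ := exists_prefix_of_prefix_flatMap_sigma h
  · rcases V.eq_nil_or_concat' with rfl | ⟨y, t, rfl⟩
    · simp at hV
    · rw [List.flatMap_append, List.flatMap_singleton] at hV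
      by_cases ht : t = e
      · rw [ht, sigma_self] at hV
        exact absurd (List.append_inj_right' hV rfl) (by simpa using ha)
      · have hxy : x ++ [a] = y.flatMap (sigma e) ++ [e] ++ [t] := by simpa [ht] using hV
        exact ⟨y, List.append_inj_left' hxy rfl⟩
  · exact absurd (List.append_inj_right' hV rfl) (by simpa using ha)

theorem singleton_prefix_flatMap_sigma_append (y Q : List α) :
    [e] <+: y.flatMap (sigma e) ++ e :: Q := by
  rcases y with _ | ⟨r, y⟩
  · simp
  · by_cases hr : r = e <;> simp [hr]

theorem append_singleton_prefix_of_flatMap_sigma_prefix {y : List α}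
    (h : y.flatMap (sigma e) ++ [e, a] <+: W.flatMap (sigma e)) : y ++ [a] <+: W := by
  induction y generalizing W with
  | nil =>
    rcases W with _ | ⟨s, W⟩
    · simp at h
    by_cases hs : s = e
    · rw [List.flatMap_cons, hs, sigma_self] at h
      have ha : a = e := eq_of_cons_prefix_flatMap_sigma ((List.prefix_append_right_inj [e]).1 h)
      simp [ha, hs]
    · rw [List.flatMap_cons, sigma_of_ne hs] at h
      have ha : a = s := (List.cons_prefix_cons.1 (List.cons_prefix_cons.1 h).2).1
      simp [ha]
  | cons t y ih =>
    rcases W with _ | ⟨s, W⟩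
    · simp at h
    rw [List.flatMap_cons, List.flatMap_cons, List.append_assoc] at h
    obtain rfl : t = s := by
      by_cases hs : s = e <;> by_cases ht : t = e
      · rw [hs, ht]
      · rw [hs, sigma_self, sigma_of_ne ht] at h
        exact absurd (eq_of_cons_prefix_flatMap_sigma ((List.prefix_append_right_inj [e]).1 h)) ht
      · rw [ht, sigma_self, sigma_of_ne hs] at h
        have := (singleton_prefix_flatMap_sigma_append y [a]).trans
          ((List.prefix_append_right_inj [e]).1 h)
        exact absurd (List.cons_prefix_cons.1 this).1.symm hs
      · rw [sigma_of_ne hs, sigma_of_ne ht] at h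
        exact (List.cons_prefix_cons.1 (List.cons_prefix_cons.1 h).2).1
    exact List.cons_prefix_cons.2 ⟨rfl, ih ((List.prefix_append_right_inj _).1 h)⟩

theorem exists_suffix_of_cons_suffix_flatMap_sigma (h : c :: Q <:+ W.flatMap (sigma e))
    (hQ : c = e → [e] <+: Q) : ∃ V, c :: V <:+ W ∧ V.flatMap (sigma e) = Q := by
  induction W with
  | nil => simp at h
  | cons s W ih =>
    have ih' (h : c :: Q <:+ W.flatMap (sigma e)) :
        ∃ V, c :: V <:+ s :: W ∧ V.flatMap (sigma e) = Q :=
      (ih h).imp fun V => And.imp_left (·.trans (List.suffix_cons s W))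
    by_cases hs : s = e
    · rw [List.flatMap_cons, hs, sigma_self, List.singleton_append, List.suffix_cons_iff,
        List.cons.injEq] at h
      rcases h with ⟨rfl, rfl⟩ | h
      · exact ⟨W, by simp [hs], rfl⟩
      · exact ih' h
    · rw [List.flatMap_cons, sigma_of_ne hs, List.cons_append, List.singleton_append,
        List.suffix_cons_iff, List.suffix_cons_iff, List.cons.injEq, List.cons.injEq] at h
      rcases h with ⟨rfl, rfl⟩ | ⟨rfl, rfl⟩ | h
      · exact absurd (List.cons_prefix_cons.1 (hQ rfl)).1.symm hs
      · exact ⟨W, List.suffix_rfl, rfl⟩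
      · exact ih' h

theorem exists_suffix_of_infix_flatMap_sigma (h : c :: x <:+: W.flatMap (sigma e))
    (hx : c = e → [e] <+: x) : ∃ V, c :: V <:+ W ∧ x <+: V.flatMap (sigma e) := by
  obtain ⟨P, Q, h⟩ := h
  obtain ⟨V, hV, hVQ⟩ := exists_suffix_of_cons_suffix_flatMap_sigma (c := c) (Q := x ++ Q)
    ⟨P, by simpa using h⟩ fun hc => (hx hc).trans (List.prefix_append _ _)
  exact ⟨V, hV, Q, hVQ.symm⟩

theorem infix_of_infix_flatMap_sigma {y : List α}
    (h : c :: (y.flatMap (sigma e) ++ [e, a]) <:+: W.flatMap (sigma e)) :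
    c :: (y ++ [a]) <:+: W := by
  obtain ⟨V, hV, hyV⟩ := exists_suffix_of_infix_flatMap_sigma h fun _ =>
    singleton_prefix_flatMap_sigma_append y [a]
  have hy : y ++ [a] <+: V := append_singleton_prefix_of_flatMap_sigma_prefix hyV
  exact ((List.prefix_cons_inj c).2 hy).isInfix.trans hV.isInfix

/-- The extension graph of a word `x` in `W` has an edge `(c, a)` for each factor `c x a` of `W`.
The property says that every edge of the graph meets every loop `(b, b)`; it is the finite trace
in `W` of the uniqueness of left special factors. -/
def HasStarExtensions (W : List α) : Prop :=
  ∀ ⦃x : List α⦄ ⦃a b c : α⦄, b :: (x ++ [b]) <:+: W → c :: (x ++ [a]) <:+: W → c = b ∨ a = b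

theorem exists_eq_flatMap_sigma_of_infix (hc : c ≠ e) (ha : a ≠ e)
    (h : c :: (x ++ [a]) <:+: W.flatMap (sigma e)) :
    ∃ y : List α, x = y.flatMap (sigma e) ++ [e] := by
  obtain ⟨V, -, hV⟩ := exists_suffix_of_infix_flatMap_sigma h fun h => absurd h hc
  exact exists_eq_flatMap_sigma_append ha hV

theorem HasStarExtensions.flatMap_sigma (hW : HasStarExtensions W) (e : α) :
    HasStarExtensions (W.flatMap (sigma e)) := by
  intro x a b c hb hca
  by_contra! hne
  obtain ⟨y, rfl⟩ : ∃ y : List α, x = y.flatMap (sigma e) ++ [e] := by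
    by_cases hbe : b = e
    · subst hbe; exact exists_eq_flatMap_sigma_of_infix hne.1 hne.2 hca
    · exact exists_eq_flatMap_sigma_of_infix hbe hbe hb
  rw [List.append_assoc] at hb hca
  exact not_or.2 hne (hW (infix_of_infix_flatMap_sigma hb) (infix_of_infix_flatMap_sigma hca))

theorem hasStarExtensions_directedWord (d : ℕ → α) (n : ℕ) (a : α) :
    HasStarExtensions (directedWord d n a) := by
  induction n generalizing d with
  | zero => exact fun x _ b _ h _ => absurd h.length_le (by simp [directedWord])
  | succ n ih => rw [directedWord_succ_eq_flatMap_sigma]; exact (ih _).flatMap_sigma _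

end Desubstitution

section Complexity

variable {α : Type*} {w : ℕ → α}

theorem exists_common_prefix_of_ne {u v : List α} (hl : u.length = v.length) (h : u ≠ v) :
    ∃ x a b, a ≠ b ∧ x ++ [a] <+: u ∧ x ++ [b] <+: v := by
  induction u generalizing v with
  | nil => exact absurd (List.length_eq_zero_iff.1 hl.symm).symm h
  | cons a u ih =>
    rcases v with _ | ⟨b, v⟩
    · simp at hl
    by_cases hab : a = b
    · subst hab
      obtain ⟨x, c, e, hce, hu, hv⟩ := ih (by simpa using hl) (by simpa using h)
      exact ⟨a :: x, c, e, hce, List.cons_prefix_cons.2 ⟨rfl, hu⟩,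
        List.cons_prefix_cons.2 ⟨rfl, hv⟩⟩
    · exact ⟨[], a, b, hab, by simp, by simp⟩

section LeftSpecial

variable {n : ℕ} (hpref : ∀ a, a :: pref w n ∈ factors w (n + 1))
  (huniq : ∀ ⦃u a b⦄, a ≠ b → a :: u ∈ factors w (n + 1) → b :: u ∈ factors w (n + 1) →
    u = pref w n)
include hpref huniq

/-- Once a single left extension `a` of the prefix of length `n` is kept, deleting the first letter
is a bijection from the remaining factors of length `n + 1` to the factors of length `n`. -/
theorem ncard_factors_succ_sdiff (a : α) :
    (factors w (n + 1) \ (· :: pref w n) '' {a}ᶜ).ncard = (factors w n).ncard := by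
  refine Set.ncard_congr (fun u _ => u.tail) ?maps ?injective ?surjective
  case maps =>
    rintro _ ⟨⟨i, rfl⟩, -⟩
    exact ⟨i + 1, by rw [block_succ, List.tail_cons]⟩
  case injective =>
    have eq_of_cons_pref {c : α} (hc : c :: pref w n ∉ (· :: pref w n) '' {a}ᶜ) : c = a :=
      of_not_not fun h => hc ⟨c, h, rfl⟩
    rintro _ _ ⟨⟨i, rfl⟩, hi⟩ ⟨⟨j, rfl⟩, hj⟩ h
    rw [block_succ] at hi
    rw [block_succ] at hj
    simp only [block_succ, List.tail_cons] at h ⊢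
    by_contra hne
    have hij : w i ≠ w j := fun hw => hne (by rw [h, hw])
    have hu : block w (i + 1) n = pref w n :=
      huniq hij ⟨i, (block_succ ..).symm⟩ ⟨j, by rw [h, block_succ]⟩
    rw [hu] at hi
    rw [← h, hu] at hj
    exact hij ((eq_of_cons_pref hi).trans (eq_of_cons_pref hj).symm)
  case surjective =>
    rintro _ ⟨i, rfl⟩
    by_cases hu : block w i n = pref w n
    · exact ⟨a :: pref w n, ⟨hpref a, by simp⟩, hu.symm⟩
    · obtain ⟨j, rfl⟩ : ∃ j, i = j + 1 :=
        Nat.exists_eq_succ_of_ne_zero fun hi => hu (by rw [hi, pref])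
      refine ⟨block w j (n + 1), ⟨⟨j, rfl⟩, ?_⟩, by rw [block_succ, List.tail_cons]⟩
      rintro ⟨c, -, hc⟩
      rw [block_succ] at hc
      exact hu (List.cons.inj hc).2.symm

theorem complexity_succ_of_leftSpecial [Finite α] :
    complexity w (n + 1) = complexity w n + (Nat.card α - 1) := by
  have hsub : (· :: pref w n) '' {w 0}ᶜ ⊆ factors w (n + 1) := by
    rintro _ ⟨c, -, rfl⟩; exact hpref c
  have hcard : ((· :: pref w n) '' {w 0}ᶜ).ncard = Nat.card α - 1 := by
    rw [Set.ncard_image_of_injective _ fun _ _ h => (List.cons.inj h).1, Set.ncard_compl,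
      Set.ncard_singleton]
  rw [complexity, complexity, ← ncard_factors_succ_sdiff hpref huniq (w 0), ← hcard,
    Set.ncard_sdiff_add_ncard_of_subset hsub (finite_factors w _)]

end LeftSpecial

variable [DecidableEq α] {d : ℕ → α}

theorem mem_factors_of_infix_directedWord (hd : ∀ a, ∃ᶠ n in atTop, d n = a) {a b : α}
    (hw : ConvergesTo (fun n => directedWord d n b) w) {u : List α} {n : ℕ}
    (hu : u <:+: directedWord d n a) : u ∈ factors w u.length := by
  obtain ⟨m, hm, rfl⟩ := frequently_atTop.1 (hd a) n
  refine mem_factors_of_infix_pref (N := (directedWord d m (d m)).length) ?_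
  rw [← hw.directedWord_eq_pref]
  exact hu.trans (directedWord_suffix_directedWord hm _).isInfix

theorem cons_pref_mem_factors (hd : ∀ a, ∃ᶠ n in atTop, d n = a) {a b : α} (hab : b ≠ a)
    (hw : ConvergesTo (fun n => directedWord d n b) w) (n : ℕ) :
    a :: pref w n ∈ factors w (n + 1) := by
  obtain ⟨m, rfl, hm⟩ := ((hd a).and_eventually (hw n)).exists
  obtain ⟨p, hp⟩ := singleton_suffix_directedWord (d := d) m (d m)
  obtain ⟨q, hq⟩ : pref w n <+: directedWord d m b := hm
  have h : d m :: pref w n <:+: directedWord d (m + 1) b :=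
    ⟨p, q, by rw [directedWord_succ_of_ne hab, ← hp, ← hq]; simp⟩
  simpa using mem_factors_of_infix_directedWord hd hw h

theorem eq_or_eq_of_infix_factors {e : α} (hw : ConvergesTo (fun n => directedWord d n e) w)
    {n m : ℕ} {u v x : List α} {a b c : α} (hu : u ∈ factors w n) (hv : v ∈ factors w m)
    (hb : b :: (x ++ [b]) <:+: u) (hca : c :: (x ++ [a]) <:+: v) : c = b ∨ a = b := by
  obtain ⟨i, rfl⟩ := hu
  obtain ⟨j, rfl⟩ := hv
  obtain ⟨k, hi, hj⟩ := ((hw (i + n)).and (hw (j + m))).exists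
  exact hasStarExtensions_directedWord d k e
    (hb.trans ((block_infix_pref w i n).trans hi.isInfix))
    (hca.trans ((block_infix_pref w j m).trans hj.isInfix))

theorem eq_pref_of_cons_mem_factors (hd : ∀ a, ∃ᶠ n in atTop, d n = a)
    (hw : ∀ a, ConvergesTo (fun n => directedWord d n a) w) {n : ℕ} {u : List α} {a b : α}
    (hab : a ≠ b) (ha : a :: u ∈ factors w (n + 1)) (hb : b :: u ∈ factors w (n + 1)) :
    u = pref w n := by
  by_contra hne
  have hlen : u.length = (pref w n).length := by
    obtain ⟨i, hi⟩ := ha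
    simpa using congrArg List.length hi
  obtain ⟨x, f, g, hfg, hx, hx'⟩ := exists_common_prefix_of_ne hlen hne
  have : Nontrivial α := ⟨a, b, hab⟩
  obtain ⟨h, hhg⟩ := exists_ne g
  have hg : g :: pref w n ∈ factors w (n + 1) := cons_pref_mem_factors hd hhg (hw h) n
  have eq_of_mem {c : α} (hc : c :: u ∈ factors w (n + 1)) : c = g :=
    (eq_or_eq_of_infix_factors (hw g) hg hc ((List.prefix_cons_inj g).2 hx').isInfix
      ((List.prefix_cons_inj c).2 hx).isInfix).resolve_right hfg
  exact hab ((eq_of_mem ha).trans (eq_of_mem hb).symm)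

theorem complexity_of_convergesTo_directedWord [Finite α] [Nontrivial α]
    (hd : ∀ a, ∃ᶠ n in atTop, d n = a)
    (hw : ∀ a, ConvergesTo (fun n => directedWord d n a) w) (n : ℕ) :
    complexity w n = (Nat.card α - 1) * n + 1 := by
  induction n with
  | zero => rw [complexity, factors_zero, Set.ncard_singleton, Nat.mul_zero]
  | succ n ih =>
    have hpref (a : α) : a :: pref w n ∈ factors w (n + 1) := by
      obtain ⟨b, hb⟩ := exists_ne a
      exact cons_pref_mem_factors hd hb (hw b) n
    rw [complexity_succ_of_leftSpecial hpref fun _ _ _ => eq_pref_of_cons_mem_factors hd hw, ih]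
    ring

end Complexity

section Binary

/-- The other letter of the binary alphabet. -/
def Letter.other : Letter → Letter
  | .one => .two
  | .two => .one

@[simp] theorem Letter.other_other (a : Letter) : a.other.other = a := by cases a <;> rfl

@[simp] theorem Letter.other_ne (a : Letter) : a.other ≠ a := by cases a <;> decide

@[simp] theorem Letter.ne_other (a : Letter) : a ≠ a.other := a.other_ne.symm

theorem Letter.eq_other_of_ne {a b : Letter} (h : b ≠ a) : b = a.other := by
  cases a <;> cases b <;> first | rfl | exact absurd rfl h

/-- The identification of the alphabet with `Bool` that counts its letters; `1` is `true`. -/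
def Letter.equivBool : Letter ≃ Bool where
  toFun a := decide (a = .one)
  invFun b := if b then .one else .two
  left_inv a := by cases a <;> rfl
  right_inv b := by cases b <;> rfl

instance : Finite Letter := .of_equiv Bool Letter.equivBool.symm

instance : Nontrivial Letter := ⟨.one, .two, by decide⟩

theorem Letter.natCard : Nat.card Letter = 2 := by
  rw [Nat.card_congr Letter.equivBool, Nat.card_eq_fintype_card, Fintype.card_bool]

theorem sigma_one : sigma Letter.one = sigma1 := by
  funext b; cases b <;> rfl

theorem sigma_two : sigma Letter.two = sigma2 := by
  funext b; cases b <;> rfl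

theorem sigma_injective : Function.Injective (sigma : Letter → Substitution) := by
  intro a b h
  by_contra hab
  simpa [hab] using congrFun h a

theorem exists_eq_sigma {s : ℕ → Substitution} (hs : ∀ n, s n = sigma1 ∨ s n = sigma2) :
    ∃ d : ℕ → Letter, s = fun n => sigma (d n) := by
  have hs' (n : ℕ) : ∃ a, s n = sigma a := (hs n).elim
    (fun h => ⟨.one, h.trans sigma_one.symm⟩) fun h => ⟨.two, h.trans sigma_two.symm⟩
  choose d hd using hs'
  exact ⟨d, funext hd⟩

theorem compose_sigma (d : ℕ → Letter) (n : ℕ) (u : List Letter) :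
    compose (fun k => sigma (d k)) n u = u.flatMap (directedWord d n) := by
  induction n generalizing u with
  | zero => exact (List.flatMap_singleton' u).symm
  | succ n ih => rw [compose, ih, Substitution.apply, List.flatMap_assoc]; rfl

theorem compose_sigma_singleton (d : ℕ → Letter) (n : ℕ) (a : Letter) :
    compose (fun k => sigma (d k)) n [a] = directedWord d n a := by
  rw [compose_sigma, List.flatMap_singleton]

theorem isSturmian_of_convergesTo_directedWord {d : ℕ → Letter} {w : ℕ → Letter}
    (hd : ∀ a, ∃ᶠ n in atTop, d n = a)
    (hw : ∀ a, ConvergesTo (fun n => directedWord d n a) w) : IsSturmian w := fun n => by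
  rw [complexity_of_convergesTo_directedWord hd hw, Letter.natCard, Nat.one_mul]

end Binary

section Counting

theorem count_add_count_other (a : Letter) (u : List Letter) :
    u.count a + u.count a.other = u.length := by
  induction u with
  | nil => rfl
  | cons c u ih =>
    rw [List.count_cons, List.count_cons, List.length_cons, ← ih]
    cases a <;> cases c <;> grind [Letter.other]

variable {d : ℕ → Letter}

theorem count_self_directedWord_succ {a : Letter} (h : d 0 = a) (n : ℕ) (b : Letter) :
    (directedWord d (n + 1) b).count a =
      (directedWord (fun k => d (k + 1)) n b).count a +
        (directedWord (fun k => d (k + 1)) n b).count a.other := by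
  rw [directedWord_succ_eq_flatMap_sigma, h, count_flatMap_sigma_self, count_add_count_other]

theorem count_other_directedWord_succ {a : Letter} (h : d 0 = a) (n : ℕ) (b : Letter) :
    (directedWord d (n + 1) b).count a.other =
      (directedWord (fun k => d (k + 1)) n b).count a.other := by
  rw [directedWord_succ_eq_flatMap_sigma, h, count_flatMap_sigma_of_ne a.other_ne]

/-- Both counting vectors are transformed by the same matrix of determinant `1` when a substitution
is removed on the left, until one of the words is a single letter. -/
theorem count_mul_count_other_le (d : ℕ → Letter) (a : Letter) (m n : ℕ) :
    (directedWord d m a.other).count a * (directedWord d n a).count a.other ≤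
      (directedWord d n a).count a * (directedWord d m a.other).count a.other := by
  induction m generalizing d n with
  | zero => simp [directedWord]
  | succ m ih =>
    rcases n with _ | n
    · have hzero : (directedWord d 0 a).count a.other = 0 := by simp [directedWord]
      rw [hzero, Nat.mul_zero]
      exact Nat.zero_le _
    have := ih (fun k => d (k + 1)) n
    by_cases h : d 0 = a
    · rw [count_self_directedWord_succ h, count_self_directedWord_succ h,
        count_other_directedWord_succ h, count_other_directedWord_succ h]
      linarith
    · have h := Letter.eq_other_of_ne h
      have hself (n : ℕ) (b : Letter) := count_self_directedWord_succ h n b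
      have hother (n : ℕ) (b : Letter) := count_other_directedWord_succ h n b
      rw [Letter.other_other] at hself hother
      rw [hself, hself, hother, hother]
      linarith

end Counting

section FrequencyRatio

/-- The deviation of the numbers of occurrences of `a` and of the other letter in `u` from the
ratio `f : g`. -/
def deviation (a : Letter) (f g : ℝ) (u : List Letter) : ℝ :=
  g * u.count a - f * u.count a.other

theorem deviation_other (a : Letter) (f g : ℝ) (u : List Letter) :
    deviation a.other g f u = -deviation a f g u := by
  simp [deviation]

@[simp] theorem deviation_nil (a : Letter) (f g : ℝ) : deviation a f g [] = 0 := by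
  simp [deviation]

theorem deviation_append (a : Letter) (f g : ℝ) (u v : List Letter) :
    deviation a f g (u ++ v) = deviation a f g u + deviation a f g v := by
  simp only [deviation, List.count_append, Nat.cast_add]
  ring

theorem deviation_flatMap_sigma (a : Letter) (f g : ℝ) (u : List Letter) :
    deviation a f g (u.flatMap (sigma a)) = deviation a (f - g) g u := by
  simp only [deviation, count_flatMap_sigma_self, count_flatMap_sigma_of_ne a.other_ne,
    ← count_add_count_other a, Nat.cast_add]
  ring

@[simp] theorem deviation_singleton_self (a : Letter) (f g : ℝ) : deviation a f g [a] = g := by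
  simp [deviation]

@[simp] theorem deviation_singleton_other (a : Letter) (f g : ℝ) :
    deviation a f g [a.other] = -f := by
  simp [deviation]

/-- The ratio `f : g` lies between the ratios of the numbers of occurrences of `a` and of the other
letter in the two words `directedWord d n a` and `directedWord d n a.other`, for all `n`. The ratio
is kept in homogeneous form, so that removing a substitution from `d` is a step of the Euclidean
algorithm on `(f, g)`. -/
def IsFrequencyRatio (d : ℕ → Letter) (a : Letter) (f g : ℝ) : Prop :=
  ∀ n, 0 ≤ deviation a f g (directedWord d n a) ∧
    deviation a f g (directedWord d n a.other) ≤ 0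

variable {d : ℕ → Letter} {a : Letter} {f g : ℝ}

theorem exists_isFrequencyRatio (h : ∃ n, d n = a.other) : ∃ f, IsFrequencyRatio d a f 1 := by
  let p (n : ℕ) (b : Letter) : ℝ := (directedWord d n b).count a
  let q (n : ℕ) (b : Letter) : ℝ := (directedWord d n b).count a.other
  have hpq (m n : ℕ) : p m a.other * q n a ≤ p n a * q m a.other := by
    simp only [p, q]
    exact_mod_cast count_mul_count_other_le d a m n
  have hq (m : ℕ) : 0 < q m a.other :=
    Nat.cast_pos.2 <| List.count_pos_iff.2 <|
      (singleton_suffix_directedWord m a.other).subset (by simp)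
  obtain ⟨k, hk⟩ := h
  have hqk : 0 < q (k + 1) a := by
    refine Nat.cast_pos.2 <| List.count_pos_iff.2 <|
      (directedWord_prefix_directedWord k.lt_succ_self a).subset ?_
    rw [hk]
    exact (singleton_suffix_directedWord k a.other).subset (by simp)
  obtain ⟨f, hlow, hupp⟩ := exists_between_of_forall_le
    (s := Set.range fun m => p m a.other / q m a.other)
    (t := {r | ∃ n, 0 < q n a ∧ r = p n a / q n a})
    (Set.range_nonempty _) ⟨_, k + 1, hqk, rfl⟩ (by
      rintro _ ⟨m, rfl⟩ _ ⟨n, hn, rfl⟩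
      exact (div_le_div_iff₀ (hq m) hn).2 (hpq m n))
  refine ⟨f, fun n => ⟨?_, ?_⟩⟩
  · rw [deviation, one_mul, sub_nonneg]
    rcases (Nat.cast_nonneg _ : 0 ≤ q n a).eq_or_lt with h0 | hpos
    · rw [← h0, mul_zero]; exact Nat.cast_nonneg _
    · exact (le_div_iff₀ hpos).1 (hupp ⟨n, hpos, rfl⟩)
  · rw [deviation, one_mul, sub_nonpos]
    exact (div_le_iff₀ (hq n)).1 (hlow ⟨n, rfl⟩)

theorem frequently_add {p : ℕ → Prop} (hp : ∃ᶠ n in atTop, p n) (k : ℕ) :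
    ∃ᶠ n in atTop, p (n + k) := by
  rwa [← map_add_atTop_eq_nat k, frequently_map] at hp

namespace IsFrequencyRatio

theorem nonneg_left (h : IsFrequencyRatio d a f g) : 0 ≤ f := by
  simpa [directedWord] using (h 0).2

theorem nonneg_right (h : IsFrequencyRatio d a f g) : 0 ≤ g := by
  simpa [directedWord] using (h 0).1

theorem other (h : IsFrequencyRatio d a f g) : IsFrequencyRatio d a.other g f := fun n => by
  rw [Letter.other_other, deviation_other, deviation_other]
  exact ⟨neg_nonneg.2 (h n).2, neg_nonpos.2 (h n).1⟩

theorem tail (h : IsFrequencyRatio d a f g) (hd : d 0 = a) :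
    IsFrequencyRatio (fun k => d (k + 1)) a (f - g) g := fun n => by
  simpa only [directedWord_succ_eq_flatMap_sigma, hd, deviation_flatMap_sigma] using h (n + 1)

theorem tail_run {k : ℕ} (h : IsFrequencyRatio d a f g) (hd : ∀ i < k, d i = a) :
    IsFrequencyRatio (fun i => d (i + k)) a (f - k * g) g := by
  induction k with
  | zero => simpa using h
  | succ k ih =>
    have := (ih fun i hi => hd i (hi.trans k.lt_succ_self)).tail (by simp [hd k k.lt_succ_self])
    simpa only [Nat.cast_succ, add_mul, one_mul, sub_sub, Nat.add_assoc, Nat.add_comm 1 k]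
      using this

theorem pos_left (h : IsFrequencyRatio d a f g) (hg : 0 < g) (hd : ∃ n, d n = a) : 0 < f := by
  refine h.nonneg_left.lt_of_ne' fun hf => ?_
  obtain ⟨n, rfl⟩ := hd
  have hmem : d n ∈ directedWord d (n + 1) (d n).other :=
    (directedWord_prefix_directedWord n.lt_succ_self _).subset <|
      (singleton_suffix_directedWord n (d n)).subset (by simp)
  have hcount : (0 : ℝ) < (directedWord d (n + 1) (d n).other).count (d n) :=
    Nat.cast_pos.2 (List.count_pos_iff.2 hmem)
  have := (h (n + 1)).2
  rw [deviation, hf, zero_mul, sub_zero] at this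
  exact this.not_gt (mul_pos hg hcount)

theorem deviation_sub_le (h : IsFrequencyRatio d a f g) {n : ℕ} {b c : Letter} {u v : List Letter}
    (hu : u <+: directedWord d n b) (hv : v <+: directedWord d n c) :
    deviation a f g u - deviation a f g v ≤ f + g := by
  induction n generalizing d a f g b c u v with
  | zero =>
    have bounds {b : Letter} {u : List Letter} (hu : u <+: [b]) :
        -f ≤ deviation a f g u ∧ deviation a f g u ≤ g := by
      have := h.nonneg_left
      have := h.nonneg_right
      obtain rfl | rfl : u = [] ∨ u = [b] := by simpa [List.prefix_cons_iff] using hu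
      · rw [deviation_nil]; constructor <;> linarith
      · by_cases hb : b = a
        · rw [hb, deviation_singleton_self]; constructor <;> linarith
        · rw [Letter.eq_other_of_ne hb, deviation_singleton_other]; constructor <;> linarith
    linarith [(bounds hu).2, (bounds hv).1]
  | succ n ih =>
    wlog hd : d 0 = a generalizing a f g b c u v
    · have := this h.other hv hu (Letter.eq_other_of_ne hd)
      rw [deviation_other, deviation_other] at this
      linarith
    -- Removing `σ_a` turns `(f, g)` into `(f - g, g)`; a last `a` cut off from its block adds `g`.
    have desubstitute {b : Letter} {u : List Letter} (hu : u <+: directedWord d (n + 1) b) :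
        ∃ U, U <+: directedWord (fun k => d (k + 1)) n b ∧
          deviation a (f - g) g U ≤ deviation a f g u ∧
          deviation a f g u ≤ deviation a (f - g) g U + g := by
      rw [directedWord_succ_eq_flatMap_sigma, hd] at hu
      obtain ⟨U, hU, rfl | rfl⟩ := exists_prefix_of_prefix_flatMap_sigma hu <;>
        refine ⟨U, hU, ?_⟩ <;>
        simp [deviation_append, deviation_flatMap_sigma, h.nonneg_right]
    obtain ⟨U, hU, -, hle⟩ := desubstitute hu
    obtain ⟨V, hV, hge, -⟩ := desubstitute hv
    linarith [ih (h.tail hd) hU hV]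

theorem abs_deviation_le (h : IsFrequencyRatio d a f g) {n : ℕ} {b : Letter} {u : List Letter}
    (hu : u <+: directedWord d n b) : |deviation a f g u| ≤ f + g := by
  have hnil : [] <+: directedWord d n b := List.nil_prefix
  have hle := h.deviation_sub_le hu hnil
  have hge := h.deviation_sub_le hnil hu
  rw [deviation_nil] at hle hge
  exact abs_le.2 ⟨by linarith, by linarith⟩

theorem hasFrequency (h : IsFrequencyRatio d a f g) (hfg : 0 < f + g) {w : ℕ → Letter} {b : Letter}
    (hw : ConvergesTo (fun n => directedWord d n b) w) : HasFrequency w a (f / (f + g)) := by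
  refine tendsto_iff_dist_tendsto_zero.2 <| squeeze_zero' (.of_forall fun _ => dist_nonneg) ?_
    tendsto_one_div_atTop_nhds_zero_nat
  filter_upwards [eventually_gt_atTop 0] with N hN
  have hN : (0 : ℝ) < N := Nat.cast_pos.2 hN
  obtain ⟨n, hn⟩ := (hw N).exists
  have hdev := h.abs_deviation_le hn
  have hlen : ((pref w N).count a : ℝ) + (pref w N).count a.other = N := by
    rw [← Nat.cast_add, count_add_count_other, length_pref]
  have hdist : ((pref w N).count a : ℝ) / N - f / (f + g) =
      deviation a f g (pref w N) / (N * (f + g)) := by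
    rw [div_sub_div _ _ hN.ne' hfg.ne', deviation]
    congr 1
    linear_combination f * hlen
  rw [Real.dist_eq, hdist, abs_div, abs_of_pos (mul_pos hN hfg), div_le_div_iff₀ (by positivity) hN]
  nlinarith

theorem euclid_step (h : IsFrequencyRatio d a f g) (hg : 0 < g) (hd : ∀ b, ∃ᶠ n in atTop, d n = b)
    {k : ℕ} (hrun : ∀ i < k, d i = a) (hk : d k ≠ a) :
    0 < f - k * g ∧ f - k * g < g ∧
      IsFrequencyRatio (fun i => d (i + k)) a.other g (f - k * g) := by
  have hpos := (h.tail_run hrun).pos_left hg (frequently_add (hd a) k).exists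
  have hother := (h.tail_run hrun).other
  have hlt := (hother.tail (by simpa using Letter.eq_other_of_ne hk)).pos_left hpos
    (by simpa only [Nat.add_assoc] using (frequently_add (hd a.other) (1 + k)).exists)
  exact ⟨hpos, sub_pos.1 hlt, hother⟩

end IsFrequencyRatio
end FrequencyRatio

section ContinuedFraction

open GenContFract in
theorem isContFractExpansion_of_invariant {b : ℕ → ℕ} {x : ℝ} (P : ℕ → ℝ → Prop) (hx : P 0 x)
    (hP : ∀ n y, P n y → ⌊y⌋ = b n ∧ Int.fract y ≠ 0 ∧ P (n + 1) (Int.fract y)⁻¹) :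
    IsContFractExpansion b x := by
  have hstream (n : ℕ) :
      ∃ y, IntFractPair.stream x n = some (IntFractPair.of y) ∧ P n y := by
    induction n with
    | zero => exact ⟨x, rfl, hx⟩
    | succ n ih =>
      obtain ⟨y, hy, hPy⟩ := ih
      obtain ⟨-, hfract, hPy'⟩ := hP n y hPy
      exact ⟨_, IntFractPair.stream_succ_of_some hy hfract, hPy'⟩
  refine ⟨by rw [of_h_eq_floor, (hP 0 x hx).1, Int.cast_natCast], fun n => ?_⟩
  obtain ⟨y, hy, hPy⟩ := hstream (n + 1)
  rw [get?_of_eq_some_of_succ_get?_intFractPair_stream hy, IntFractPair.of, (hP _ y hPy).1,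
    Int.cast_natCast]

theorem floor_div_and_fract_div {f g : ℝ} {k : ℕ} (hpos : 0 ≤ f - k * g) (hlt : f - k * g < g) :
    ⌊f / g⌋ = k ∧ Int.fract (f / g) = (f - k * g) / g := by
  have hg : 0 < g := hpos.trans_lt hlt
  have hfloor : ⌊f / g⌋ = k := by
    rw [Int.floor_eq_iff, Int.cast_natCast, le_div_iff₀ hg, div_lt_iff₀ hg]
    constructor <;> linarith
  refine ⟨hfloor, ?_⟩
  rw [Int.fract, hfloor, Int.cast_natCast, sub_div, mul_div_cancel_right₀ _ hg.ne']

/-- The letter `a` such that the `k`-th run consists of `σ_a`'s. -/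
def runLetter (k : ℕ) : Letter :=
  if Even k then .one else .two

theorem runLetter_succ (k : ℕ) : runLetter (k + 1) = (runLetter k).other := by
  by_cases h : Even k <;> simp [runLetter, Nat.even_add_one, h, Letter.other]

theorem runValue_eq_sigma (k : ℕ) : runValue k = sigma (runLetter k) := by
  by_cases h : Even k <;> simp [runLetter, runValue, h, sigma_one, sigma_two]

variable {d : ℕ → Letter}

theorem runStart_sigma_succ (d : ℕ → Letter) (k : ℕ) :
    runStart (fun n => sigma (d n)) (k + 1) =
      sInf {n | runStart (fun n => sigma (d n)) k ≤ n ∧ d n ≠ runLetter k} := by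
  simp only [runStart, runValue_eq_sigma, sigma_injective.ne_iff]

theorem runStart_succ_mem (hd : ∀ a, ∃ᶠ n in atTop, d n = a) (k : ℕ) :
    runStart (fun n => sigma (d n)) k ≤ runStart (fun n => sigma (d n)) (k + 1) ∧
      d (runStart (fun n => sigma (d n)) (k + 1)) ≠ runLetter k := by
  obtain ⟨n, hn, h⟩ := frequently_atTop.1 (hd (runLetter k).other) (runStart _ k)
  rw [runStart_sigma_succ]
  exact Nat.sInf_mem (s := {n | _ ≤ n ∧ d n ≠ runLetter k}) ⟨n, hn, by simp [h]⟩

theorem eq_runLetter_of_lt_runLength {k i : ℕ} (hi : i < runLength (fun n => sigma (d n)) k) :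
    d (i + runStart (fun n => sigma (d n)) k) = runLetter k := by
  by_contra h
  rw [runLength, runStart_sigma_succ] at hi
  exact Nat.notMem_of_lt_sInf (Nat.add_lt_of_lt_sub hi) ⟨Nat.le_add_left _ _, h⟩

theorem IsFrequencyRatio.isContFractExpansion {f g : ℝ} (h : IsFrequencyRatio d .one f g)
    (hg : 0 < g) (hd : ∀ a, ∃ᶠ n in atTop, d n = a) :
    IsContFractExpansion (runLength fun n => sigma (d n)) (f / g) := by
  let start := runStart fun n => sigma (d n)
  refine isContFractExpansion_of_invariant
    (fun n y => ∃ f g, 0 < g ∧ y = f / g ∧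
      IsFrequencyRatio (fun i => d (i + start n)) (runLetter n) f g) ⟨f, g, hg, rfl, h⟩ ?_
  rintro n _ ⟨f, g, hg, rfl, h⟩
  obtain ⟨hle, hne⟩ := runStart_succ_mem hd n
  have hstart : runLength (fun n => sigma (d n)) n + start n = start (n + 1) :=
    Nat.sub_add_cancel hle
  obtain ⟨hpos, hlt, hnext⟩ := h.euclid_step hg (fun b => frequently_add (hd b) _)
    (fun i => eq_runLetter_of_lt_runLength) (by rwa [hstart])
  obtain ⟨hfloor, hfract⟩ := floor_div_and_fract_div hpos.le hlt
  rw [hfract, inv_div, runLetter_succ]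
  refine ⟨hfloor, (div_pos hpos hg).ne', _, _, hpos, rfl, ?_⟩
  simpa only [Nat.add_assoc, hstart] using hnext

end ContinuedFraction

end SturmianWords

theorem mainTheorem7 (s : ℕ → Substitution)
    (hs : ∀ n, s n = sigma1 ∨ s n = sigma2)
    (h1 : ∃ᶠ n in atTop, s n = sigma1)
    (h2 : ∃ᶠ n in atTop, s n = sigma2) :
    ∃ w₀ : ℕ → Letter,
      ConvergesTo (fun n => compose s n [Letter.one]) w₀ ∧
      ConvergesTo (fun n => compose s n [Letter.two]) w₀ ∧
      IsSturmian w₀ ∧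
      ∃ f₁ f₂ : ℝ,
        HasFrequency w₀ Letter.one f₁ ∧
        HasFrequency w₀ Letter.two f₂ ∧
        f₂ ≠ 0 ∧
        IsContFractExpansion (runLength s) (f₁ / f₂) := by
  obtain ⟨d, rfl⟩ := exists_eq_sigma hs
  have hd : ∀ a, ∃ᶠ n in atTop, d n = a
    | .one => by simpa only [← sigma_one, sigma_injective.eq_iff] using h1
    | .two => by simpa only [← sigma_two, sigma_injective.eq_iff] using h2
  obtain ⟨w, hw⟩ := exists_convergesTo_directedWord
    fun a => (hd a.other).mono fun n hn => hn.trans_ne a.other_ne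
  obtain ⟨f, hf⟩ := exists_isFrequencyRatio (hd Letter.one.other).exists
  have hf₀ : 0 ≤ f := hf.nonneg_left
  have hratio : f / (f + 1) / (1 / (1 + f)) = f / 1 := by field_simp; ring
  simp only [compose_sigma_singleton]
  exact ⟨w, hw .one, hw .two, isSturmian_of_convergesTo_directedWord hd hw,
    f / (f + 1), 1 / (1 + f), hf.hasFrequency (by positivity) (hw .one),
    hf.other.hasFrequency (by positivity) (hw .one), by positivity,
    hratio ▸ hf.isContFractExpansion one_pos hd⟩
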